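/- Theorem 1.13. All rings are associative with unity, and a subring contains the unity of the overring. A proper ideal $P$ of a ring $A$ is prime if $aAb\subseteq P$ implies $a\in P$ or $b\in P$; a prime factor of $A$ is a ring $A/P$ with $P$ a prime ideal; the prime radical $\mathcal P(A)$ is the intersection of all prime ideals of $A$. A ring $A$ is strongly $\pi$-regular if for each $x\in A$ there is a positive integer $n$ with $x^n\in x^{n+1}A$. Let $T$ be a ring, $R$ a subring of $T$, and $$\mathcal E_{\mathcal P}=\{e=e^2\in T \mid e+\mathcal P(T)\text{ is central in }T/\mathcal P(T)\}.$$ Let $\emptyset\ne\mathcal E\subseteq\mathcal E_{\mathcal P}$ and let $S=\langle R\cup\mathcal E\rangle_T$ be the subring of $T$ generated by $R\cup\mathcal E$. Then: (i) $\mathcal E_{\mathcal P}$ contains every inner Peirce trivial idempotent of $T$ (that is, every $e=e^2\in T$ with $exye=exeye$ for all $x,y\in T$) and every outer Peirce trivial idempotent of $T$ (that is, every $e=e^2\in T$ with $xey+exeye=xeye+exey$ for all $x,y\in T$). (ii) Let $\mathcal C$ be a property of rings, invariant under ring isomorphism, such that a ring $A$ has $\mathcal C$ if and only if every prime factor of $A$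 has $\mathcal C$. Then $R$ has $\mathcal C$ if and only if $S$ has $\mathcal C$. (iii) In particular, $R$ is strongly $\pi$-regular if and only if $S$ is strongly $\pi$-regular. -/

import Mathlib

universe u

/-- A two-sided ideal `P` of a unital ring is prime: it is proper and `a A b ⊆ P` forces `a ∈ P` or
`b ∈ P`. -/
def TwoSidedIdeal.IsPrimeIdeal {A : Type u} [Ring A] (P : TwoSidedIdeal A) : Prop :=
  P ≠ ⊤ ∧ ∀ a b : A, (∀ x : A, a * x * b ∈ P) → a ∈ P ∨ b ∈ P

/-- The prime radical of `A`: the intersection of all its prime ideals. -/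
def primeRadical (A : Type u) [Ring A] : TwoSidedIdeal A :=
  sInf {P : TwoSidedIdeal A | P.IsPrimeIdeal}

/-- The idempotents of `A` whose image in `A / primeRadical A` is central. -/
def idempotentsCentralModPrimeRadical (A : Type u) [Ring A] : Set A :=
  {e : A | IsIdempotentElem e ∧
    (primeRadical A).ringCon.mk' e ∈ Subring.center (primeRadical A).ringCon.Quotient}

/-- `e` is an inner Peirce trivial idempotent of `A`. -/
def IsInnerPeirceTrivial {A : Type u} [Ring A] (e : A) : Prop :=
  IsIdempotentElem e ∧ ∀ x y : A, e * x * y * e = e * x * e * y * e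

/-- `e` is an outer Peirce trivial idempotent of `A`. -/
def IsOuterPeirceTrivial {A : Type u} [Ring A] (e : A) : Prop :=
  IsIdempotentElem e ∧
    ∀ x y : A, x * e * y + e * x * e * y * e = x * e * y * e + e * x * e * y

/-- `A` is strongly π-regular: every `x` has a power `x ^ n`, `n ≥ 1`, lying in `x ^ (n + 1) A`. -/
def IsStronglyPiRegular (A : Type u) [Ring A] : Prop :=
  ∀ x : A, ∃ n : ℕ, 0 < n ∧ ∃ y : A, x ^ n = x ^ (n + 1) * y

/-- A predicate on rings is a ring property: it is invariant under ring isomorphism. -/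
def IsRingProperty (C : ∀ (A : Type u) [Ring A], Prop) : Prop :=
  ∀ (A B : Type u) [Ring A] [Ring B], Nonempty (A ≃+* B) → (C A ↔ C B)

/-- A ring has `C` if and only if each of its prime factor rings (quotients by prime ideals)
has `C`. -/
def IsDetectedByPrimeFactors (C : ∀ (A : Type u) [Ring A], Prop) : Prop :=
  ∀ (A : Type u) [Ring A],
    C A ↔ ∀ P : TwoSidedIdeal A, P.IsPrimeIdeal → C P.ringCon.Quotient

/-! In a prime ring a central idempotent is 0 or 1. Let P be a prime ideal of S. The commutators of
e ∈ E with S lie in the prime radical of T, which contracts into that of S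
(`comap_primeRadical_le`), hence into P. So e is 0 or 1 modulo P, S = R + P, and S/P ≅ R/(P ∩ R).
Conversely, every prime of R is contracted from S (`IsPrimeIdeal.exists_comap_eq`). Thus R and S
have the same prime factors up to isomorphism, and any property detected by these transfers.

Strong π-regularity is detected: if x violates it, an ideal maximal among those containing no x ^ n
- x ^ (n + 1) * y with n ≥ 1 is prime, and x still violates it in the quotient.

For Peirce trivial e, each t in e A (1 - e) or (1 - e) A e satisfies t A t = 0, so t lies in every
prime. -/

namespace TwoSidedIdeal

variable {A : Type u} [Ring A]

/-! ### Prime ideals obtained from maximality -/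

theorem exists_maximal_disjoint {M : Set A} (h0 : (0 : A) ∉ M) :
    ∃ P : TwoSidedIdeal A, Maximal (fun I : TwoSidedIdeal A => ∀ m ∈ M, m ∉ I) P := by
  have key := zorn_le_nonempty₀ {I : TwoSidedIdeal A | ∀ m ∈ M, m ∉ I} ?_ ⊥ ?_
  · obtain ⟨P, -, hP⟩ := key
    exact ⟨P, hP⟩
  · intro c hc hchain I₀ hI₀
    refine ⟨mk' {x | ∃ I ∈ c, x ∈ I} ⟨I₀, hI₀, I₀.zero_mem⟩ ?_ ?_ ?_ ?_, ?_, ?_⟩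
    · rintro x y ⟨I, hI, hx⟩ ⟨J, hJ, hy⟩
      rcases hchain.total hI hJ with h | h
      · exact ⟨J, hJ, J.add_mem (h hx) hy⟩
      · exact ⟨I, hI, I.add_mem hx (h hy)⟩
    · rintro x ⟨I, hI, hx⟩
      exact ⟨I, hI, I.neg_mem hx⟩
    · rintro x y ⟨I, hI, hy⟩
      exact ⟨I, hI, I.mul_mem_left _ _ hy⟩
    · rintro x y ⟨I, hI, hx⟩
      exact ⟨I, hI, I.mul_mem_right _ _ hx⟩
    · intro m hm hmem
      rw [mem_mk'] at hmem
      obtain ⟨I, hI, hx⟩ := hmem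
      exact hc hI m hm hx
    · intro I hI x hx
      rw [mem_mk']
      exact ⟨I, hI, hx⟩
  · intro m hm hmem
    rw [mem_bot] at hmem
    exact h0 (hmem ▸ hm)

/-- The ideal of all `a` with `a A b ⊆ P` for every `b ∈ s`. -/
def leftColon (P : TwoSidedIdeal A) (s : Set A) : TwoSidedIdeal A :=
  mk' {a | ∀ b ∈ s, ∀ x, a * x * b ∈ P}
    (fun _ _ _ => by simp)
    (fun ha ha' b hb x => by
      rw [add_mul, add_mul]; exact P.add_mem (ha b hb x) (ha' b hb x))
    (fun ha b hb x => by
      rw [neg_mul, neg_mul]; exact P.neg_mem (ha b hb x))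
    (fun ha b hb x => by
      rw [mul_assoc, mul_assoc, ← mul_assoc _ x]; exact P.mul_mem_left _ _ (ha b hb x))
    (fun ha b hb x => by
      rw [mul_assoc _ _ x]; exact ha b hb _)

/-- The ideal of all `b` with `a A b ⊆ P` for every `a ∈ s`. -/
def rightColon (P : TwoSidedIdeal A) (s : Set A) : TwoSidedIdeal A :=
  mk' {b | ∀ a ∈ s, ∀ x, a * x * b ∈ P}
    (fun _ _ _ => by simp)
    (fun hb hb' a ha x => by
      rw [mul_add]; exact P.add_mem (hb a ha x) (hb' a ha x))
    (fun hb a ha x => by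
      rw [mul_neg]; exact P.neg_mem (hb a ha x))
    (fun hb a ha x => by
      rw [← mul_assoc, mul_assoc a]; exact hb a ha _)
    (fun hb a ha x => by
      rw [← mul_assoc]; exact P.mul_mem_right _ _ (hb a ha x))

theorem mem_leftColon {P : TwoSidedIdeal A} {s : Set A} {a : A} :
    a ∈ P.leftColon s ↔ ∀ b ∈ s, ∀ x, a * x * b ∈ P := mem_mk' ..

theorem mem_rightColon {P : TwoSidedIdeal A} {s : Set A} {b : A} :
    b ∈ P.rightColon s ↔ ∀ a ∈ s, ∀ x, a * x * b ∈ P := mem_mk' ..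

theorem le_leftColon (P : TwoSidedIdeal A) (s : Set A) : P ≤ P.leftColon s := fun _ ha =>
  mem_leftColon.2 fun _ _ _ => P.mul_mem_right _ _ (P.mul_mem_right _ _ ha)

theorem le_rightColon (P : TwoSidedIdeal A) (s : Set A) : P ≤ P.rightColon s := fun _ hb =>
  mem_rightColon.2 fun _ _ _ => P.mul_mem_left _ _ hb

/-- An ideal maximal among those disjoint from `M` is prime, provided that whenever `I` and `J` meet
`M`, so does every ideal containing `I J`. -/
theorem isPrimeIdeal_of_maximal_disjoint {M : Set A} (hM : M.Nonempty) {P : TwoSidedIdeal A}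
    (hP : Maximal (fun I : TwoSidedIdeal A => ∀ m ∈ M, m ∉ I) P)
    (hmul : ∀ I J : TwoSidedIdeal A, (∀ a ∈ I, ∀ b ∈ J, a * b ∈ P) →
      ∀ m ∈ M, m ∈ I → ∀ n ∈ M, n ∈ J → ∃ k ∈ M, k ∈ P) :
    P.IsPrimeIdeal := by
  have meets : ∀ (I : TwoSidedIdeal A) (a : A), P ≤ I → a ∈ I → a ∉ P → ∃ m ∈ M, m ∈ I := by
    intro I a hle ha haP
    by_contra! hI
    exact haP (hP.2 hI hle ha)
  refine ⟨?_, fun a b hab => ?_⟩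
  · rintro rfl
    obtain ⟨m, hm⟩ := hM
    exact hP.1 m hm (mem_top _)
  · by_contra! hcon
    -- The two colon ideals strictly contain P, as they contain a and b, yet their product lies in P
    -- (take x = 1).
    have haI : a ∈ P.leftColon {b} := mem_leftColon.2 fun c hc x => by
      rw [Set.mem_singleton_iff.1 hc]; exact hab x
    have hbJ : b ∈ P.rightColon (P.leftColon {b}) := mem_rightColon.2 fun c hc x =>
      mem_leftColon.1 hc b rfl x
    obtain ⟨m, hm, hmI⟩ := meets _ a (le_leftColon _ _) haI hcon.1
    obtain ⟨n, hn, hnJ⟩ := meets _ b (le_rightColon _ _) hbJ hcon.2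
    obtain ⟨k, hk, hkP⟩ := hmul _ _
      (fun x hx y hy => by simpa using mem_rightColon.1 hy x hx 1) m hm hmI n hn hnJ
    exact hP.1 k hk hkP

theorem mk'_eq_zero_iff {I : TwoSidedIdeal A} {x : A} : I.ringCon.mk' x = 0 ↔ x ∈ I := by
  rw [← mem_ker, ker_ringCon_mk']

theorem mk'_mem_center_iff {I : TwoSidedIdeal A} {e : A} :
    I.ringCon.mk' e ∈ Subring.center I.ringCon.Quotient ↔ ∀ x, x * e - e * x ∈ I := by
  rw [Subring.mem_center_iff, I.ringCon.mk'_surjective.forall]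
  refine forall_congr' fun x => ?_
  rw [← mk'_eq_zero_iff, map_sub, map_mul, map_mul, sub_eq_zero]

theorem mem_primeRadical {x : A} :
    x ∈ primeRadical A ↔ ∀ P : TwoSidedIdeal A, P.IsPrimeIdeal → x ∈ P := mem_sInf _

theorem IsPrimeIdeal.mem_of_mul_self {P : TwoSidedIdeal A} (hP : P.IsPrimeIdeal) {a : A}
    (h : ∀ x, a * x * a ∈ P) : a ∈ P := (hP.2 a a h).elim id id

/-- An idempotent whose commutators lie in a prime ideal is `0` or `1` modulo that ideal. -/
theorem IsPrimeIdeal.mem_or_one_sub_mem {P : TwoSidedIdeal A} (hP : P.IsPrimeIdeal) {e : A}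
    (he : IsIdempotentElem e) (hc : ∀ x, x * e - e * x ∈ P) : e ∈ P ∨ 1 - e ∈ P := by
  refine hP.2 _ _ fun x => ?_
  have h : e * x * (1 - e) = -((x * e - e * x) * (1 - e)) := by
    have := he.eq
    linear_combination (norm := noncomm_ring) -x * this
  rw [h]
  exact P.neg_mem (P.mul_mem_right _ _ (hc x))

/-! ### Contraction of prime ideals to a subring -/

section LyingOver

variable {B : Type u} [Ring B] (f : A →+* B)

/-- Over a prime ideal `Q` of a subring there is a prime ideal of the overring that is maximal among
the ideals contracting into `Q`. -/
theorem IsPrimeIdeal.exists_maximal_comap_le (hf : Function.Injective f) {Q : TwoSidedIdeal A}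
    (hQ : Q.IsPrimeIdeal) :
    ∃ P : TwoSidedIdeal B, P.IsPrimeIdeal ∧
      Maximal (fun I : TwoSidedIdeal B => I.comap f ≤ Q) P := by
  have hiff : (fun I : TwoSidedIdeal B => ∀ m ∈ f '' {a | a ∉ Q}, m ∉ I) =
      fun I => I.comap f ≤ Q := by
    funext I
    rw [Set.forall_mem_image, eq_iff_iff]
    exact forall_congr' fun a => by rw [mem_comap]; exact not_imp_not
  have h0 : (0 : B) ∉ f '' {a | a ∉ Q} := by
    rintro ⟨a, ha, h⟩
    rw [(map_eq_zero_iff f hf).1 h] at ha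
    exact ha Q.zero_mem
  obtain ⟨P, hP⟩ := exists_maximal_disjoint h0
  refine ⟨P, isPrimeIdeal_of_maximal_disjoint ?_ hP ?_, hiff ▸ hP⟩
  · exact ⟨f 1, 1, fun h => hQ.1 (Q.one_mem_iff.1 h), rfl⟩
  · rintro I J hIJ _ ⟨a, ha, rfl⟩ haI _ ⟨b, hb, rfl⟩ hbJ
    -- The complement of Q is an m-system: some a x b stays outside Q, and its image lies in I J ⊆
    -- P.
    have : ∃ x, a * x * b ∉ Q := by
      by_contra! h
      exact (hQ.2 a b h).elim ha hb
    obtain ⟨x, hx⟩ := this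
    refine ⟨f (a * x * b), ⟨_, hx, rfl⟩, ?_⟩
    rw [map_mul, map_mul]
    exact hIJ _ (I.mul_mem_right _ _ haI) _ hbJ

/-- The prime radical of the overring contracts into the prime radical of the subring. -/
theorem comap_primeRadical_le (hf : Function.Injective f) :
    (primeRadical B).comap f ≤ primeRadical A := by
  intro x hx
  refine mem_primeRadical.2 fun Q hQ => ?_
  obtain ⟨P, hP, hmax⟩ := hQ.exists_maximal_comap_le f hf
  rw [mem_comap] at hx
  exact hmax.1 ((mem_comap f).2 (mem_primeRadical.1 hx P hP))

/-- `B = f(A) + P`. -/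
def SpannedModulo (P : TwoSidedIdeal B) : Prop := ∀ s : B, ∃ a : A, s - f a ∈ P

variable {f}

theorem IsPrimeIdeal.comap {P : TwoSidedIdeal B} (hP : P.IsPrimeIdeal)
    (hspan : SpannedModulo f P) : (P.comap f).IsPrimeIdeal := by
  refine ⟨fun h => hP.1 ?_, fun a b hab => ?_⟩
  · rw [← one_mem_iff, mem_comap, map_one] at h
    exact P.one_mem_iff.1 h
  · rw [mem_comap, mem_comap]
    refine hP.2 _ _ fun s => ?_
    obtain ⟨x, hx⟩ := hspan s
    have h1 := hab x
    rw [mem_comap, map_mul, map_mul] at h1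
    have h2 := P.add_mem (P.mul_mem_right _ (f b) (P.mul_mem_left (f a) _ hx)) h1
    convert h2 using 1
    noncomm_ring

theorem nonempty_quotient_comap_equiv {P : TwoSidedIdeal B} (hspan : SpannedModulo f P) :
    Nonempty ((P.comap f).ringCon.Quotient ≃+* P.ringCon.Quotient) := by
  have hsurj : Function.Surjective (P.ringCon.mk'.comp f) := by
    intro q
    obtain ⟨s, rfl⟩ := P.ringCon.mk'_surjective q
    obtain ⟨a, ha⟩ := hspan s
    refine ⟨a, ?_⟩
    rw [← mk'_eq_zero_iff, map_sub, sub_eq_zero] at ha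
    exact ha.symm
  have hker : (P.comap f).ringCon = RingCon.ker (P.ringCon.mk'.comp f) := by
    ext x y
    rw [rel_iff, mem_comap, map_sub, ← mk'_eq_zero_iff, map_sub, sub_eq_zero]
    rfl
  rw [hker]
  exact ⟨RingCon.quotientKerEquivOfSurjective _ hsurj⟩

/-- If `B = f(A) + P` for all prime ideals `P` of `B`, each prime ideal of `A` is contracted. -/
theorem IsPrimeIdeal.exists_comap_eq (hf : Function.Injective f)
    (hspan : ∀ P : TwoSidedIdeal B, P.IsPrimeIdeal → SpannedModulo f P)
    {Q : TwoSidedIdeal A} (hQ : Q.IsPrimeIdeal) :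
    ∃ P : TwoSidedIdeal B, P.IsPrimeIdeal ∧ P.comap f = Q := by
  obtain ⟨P, hP, hmax⟩ := hQ.exists_maximal_comap_le f hf
  refine ⟨P, hP, le_antisymm hmax.1 fun q hq => (mem_comap f).2 ?_⟩
  -- J = f(Q) + P is two-sided because B = f(A) + P. It still contracts into Q, so maximality of P
  -- forces f(Q) ⊆ P.
  let J : TwoSidedIdeal B := mk' {s | ∃ q ∈ Q, s - f q ∈ P}
    ⟨0, Q.zero_mem, by simp⟩
    (by
      rintro x y ⟨a, ha, hx⟩ ⟨b, hb, hy⟩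
      refine ⟨a + b, Q.add_mem ha hb, ?_⟩
      rw [map_add, add_sub_add_comm]
      exact P.add_mem hx hy)
    (by
      rintro x ⟨a, ha, hx⟩
      refine ⟨-a, Q.neg_mem ha, ?_⟩
      rw [map_neg, ← neg_sub']
      exact P.neg_mem hx)
    (by
      rintro s y ⟨b, hb, hy⟩
      obtain ⟨a, ha⟩ := hspan P hP s
      refine ⟨a * b, Q.mul_mem_left _ _ hb, ?_⟩
      have := P.add_mem (P.mul_mem_left s _ hy) (P.mul_mem_right _ (f b) ha)
      convert this using 1
      rw [map_mul]
      noncomm_ring)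
    (by
      rintro x s ⟨b, hb, hx⟩
      obtain ⟨a, ha⟩ := hspan P hP s
      refine ⟨b * a, Q.mul_mem_right _ _ hb, ?_⟩
      have := P.add_mem (P.mul_mem_right _ s hx) (P.mul_mem_left (f b) _ ha)
      convert this using 1
      rw [map_mul]
      noncomm_ring)
  have hJ : ∀ s, s ∈ J ↔ ∃ q ∈ Q, s - f q ∈ P := fun s => mem_mk' ..
  refine hmax.2 (y := J) (fun a ha => ?_) (fun s hs => ?_) ((hJ _).2 ⟨q, hq, ?_⟩)
  · rw [mem_comap, hJ] at ha
    obtain ⟨b, hb, hab⟩ := ha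
    rw [← map_sub] at hab
    simpa using Q.add_mem (hmax.1 ((mem_comap f).2 hab)) hb
  · exact (hJ s).2 ⟨0, Q.zero_mem, by simpa using hs⟩
  · simp

end LyingOver

end TwoSidedIdeal

open TwoSidedIdeal

/-- A property detected by prime factors passes between `A` and `B` when `A` embeds in `B` and
`B = f(A) + P` for all prime ideals `P` of `B`. -/
theorem IsDetectedByPrimeFactors.iff_of_spannedModulo {C : ∀ (A : Type u) [Ring A], Prop}
    (hiso : IsRingProperty C) (hC : IsDetectedByPrimeFactors C)
    {A B : Type u} [Ring A] [Ring B] {f : A →+* B} (hf : Function.Injective f)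
    (hspan : ∀ P : TwoSidedIdeal B, P.IsPrimeIdeal → SpannedModulo f P) : C A ↔ C B := by
  rw [hC A, hC B]
  constructor
  · intro h P hP
    exact (hiso _ _ (nonempty_quotient_comap_equiv (hspan P hP))).1 (h _ (hP.comap (hspan P hP)))
  · intro h Q hQ
    obtain ⟨P, hP, rfl⟩ := hQ.exists_comap_eq hf hspan
    exact (hiso _ _ (nonempty_quotient_comap_equiv (hspan P hP))).2 (h P hP)

/-! ### Idempotents central modulo the prime radical -/

section Idempotents

variable {A : Type u} [Ring A]

theorem mem_idempotentsCentralModPrimeRadical {e : A} :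
    e ∈ idempotentsCentralModPrimeRadical A ↔
      IsIdempotentElem e ∧ ∀ x, x * e - e * x ∈ primeRadical A := by
  rw [← mk'_mem_center_iff]
  rfl

/-- If `e A (1 - e) A e = 0` or `(1 - e) A e A (1 - e) = 0`, then `e` is central modulo the prime
radical. -/
theorem IsIdempotentElem.mem_idempotentsCentralModPrimeRadical {e : A} (he : IsIdempotentElem e)
    (h : (∀ x y, e * x * (1 - e) * y * e = 0) ∨ (∀ x y, (1 - e) * x * e * y * (1 - e) = 0)) :
    e ∈ idempotentsCentralModPrimeRadical A := by
  refine _root_.mem_idempotentsCentralModPrimeRadical.2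
    ⟨he, fun x => mem_primeRadical.2 fun P hP => ?_⟩
  -- The product t y t, with t = e x (1 - e), contains both patterns e _ (1 - e) _ e and (1 - e) _ e
  -- _ (1 - e), so either alternative kills it.
  have h1 : e * x * (1 - e) ∈ P := hP.mem_of_mul_self fun y => by
    convert P.zero_mem
    rcases h with h | h
    · calc e * x * (1 - e) * y * (e * x * (1 - e))
          = (e * x * (1 - e) * y * e) * (x * (1 - e)) := by simp only [mul_assoc]
        _ = 0 := by rw [h, zero_mul]
    · calc e * x * (1 - e) * y * (e * x * (1 - e))
          = e * x * ((1 - e) * y * e * x * (1 - e)) := by simp only [mul_assoc]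
        _ = 0 := by rw [h, mul_zero]
  have h2 : (1 - e) * x * e ∈ P := hP.mem_of_mul_self fun y => by
    convert P.zero_mem
    rcases h with h | h
    · calc (1 - e) * x * e * y * ((1 - e) * x * e)
          = (1 - e) * x * (e * y * (1 - e) * x * e) := by simp only [mul_assoc]
        _ = 0 := by rw [h, mul_zero]
    · calc (1 - e) * x * e * y * ((1 - e) * x * e)
          = ((1 - e) * x * e * y * (1 - e)) * (x * e) := by simp only [mul_assoc]
        _ = 0 := by rw [h, zero_mul]
  -- x e - e x = (1 - e) x e - e x (1 - e).
  convert P.sub_mem h2 h1 using 1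
  noncomm_ring

theorem IsInnerPeirceTrivial.mem_idempotentsCentralModPrimeRadical {e : A}
    (he : IsInnerPeirceTrivial e) : e ∈ idempotentsCentralModPrimeRadical A := by
  refine he.1.mem_idempotentsCentralModPrimeRadical (.inl fun x y => ?_)
  have := he.2 x y
  rw [mul_sub, mul_one, sub_mul, sub_mul, this, sub_self]

theorem IsOuterPeirceTrivial.mem_idempotentsCentralModPrimeRadical {e : A}
    (he : IsOuterPeirceTrivial e) : e ∈ idempotentsCentralModPrimeRadical A := by
  refine he.1.mem_idempotentsCentralModPrimeRadical (.inr fun x y => ?_)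
  calc (1 - e) * x * e * y * (1 - e)
      = (x * e * y + e * x * e * y * e) - (x * e * y * e + e * x * e * y) := by noncomm_ring
    _ = 0 := by rw [he.2 x y, sub_self]

/-- Modulo a prime ideal, adjoining idempotents that are central modulo the prime radical adds
nothing. -/
theorem spannedModulo_inclusion_closure {R : Subring A} {E : Set A}
    (hE : E ⊆ idempotentsCentralModPrimeRadical A)
    (hR : R ≤ Subring.closure ((R : Set A) ∪ E))
    {P : TwoSidedIdeal (Subring.closure ((R : Set A) ∪ E))} (hP : P.IsPrimeIdeal) :
    SpannedModulo (Subring.inclusion hR) P := by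
  rintro ⟨s, hs⟩
  induction hs using Subring.closure_induction with
  | mem x hx =>
    rcases hx with hx | hx
    · exact ⟨⟨x, hx⟩, by convert P.zero_mem; exact sub_self _⟩
    · obtain ⟨hid, hcomm⟩ := mem_idempotentsCentralModPrimeRadical.1 (hE hx)
      have hx' : x ∈ Subring.closure ((R : Set A) ∪ E) := Subring.subset_closure (Or.inr hx)
      rcases hP.mem_or_one_sub_mem (e := ⟨x, hx'⟩) (Subtype.ext hid) (fun y =>
        mem_primeRadical.1 (comap_primeRadical_le (Subring.closure ((R : Set A) ∪ E)).subtype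
          Subtype.val_injective ((mem_comap _).2 (hcomm y))) P hP) with h | h
      · exact ⟨0, by rwa [map_zero, sub_zero]⟩
      · exact ⟨1, by rw [map_one, ← neg_sub]; exact P.neg_mem h⟩
  | zero => exact ⟨0, by convert P.zero_mem; rw [map_zero, sub_zero]; rfl⟩
  | one => exact ⟨1, by convert P.zero_mem; rw [map_one]; exact sub_self _⟩
  | add x y hx hy ihx ihy =>
    obtain ⟨a, ha⟩ := ihx
    obtain ⟨b, hb⟩ := ihy
    refine ⟨a + b, ?_⟩
    convert P.add_mem ha hb using 1
    rw [map_add, ← add_sub_add_comm]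
    rfl
  | neg x hx ih =>
    obtain ⟨a, ha⟩ := ih
    refine ⟨-a, ?_⟩
    convert P.neg_mem ha using 1
    rw [map_neg, neg_sub']
    rfl
  | mul x y hx hy ihx ihy =>
    obtain ⟨a, ha⟩ := ihx
    obtain ⟨b, hb⟩ := ihy
    refine ⟨a * b, ?_⟩
    have h := P.add_mem (P.mul_mem_right _ ⟨y, hy⟩ ha)
      (P.mul_mem_left (Subring.inclusion hR a) _ hb)
    convert h using 1
    rw [map_mul, sub_mul, mul_sub, sub_add_sub_cancel]
    rfl

end Idempotents

/-! ### Strong π-regularity and prime factors -/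

section StronglyPiRegular

theorem IsStronglyPiRegular.of_surjective {A B : Type u} [Ring A] [Ring B]
    (hA : IsStronglyPiRegular A) (f : A →+* B) (hf : Function.Surjective f) :
    IsStronglyPiRegular B := by
  intro b
  obtain ⟨x, rfl⟩ := hf b
  obtain ⟨n, hn, y, hy⟩ := hA x
  exact ⟨n, hn, f y, by rw [← map_pow, ← map_pow, ← map_mul, ← hy]⟩

theorem isRingProperty_isStronglyPiRegular : IsRingProperty IsStronglyPiRegular.{u} := by
  rintro A B _ _ ⟨φ⟩
  exact ⟨fun h => h.of_surjective (φ : A →+* B) φ.surjective,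
    fun h => h.of_surjective (φ.symm : B →+* A) φ.symm.surjective⟩

variable {A : Type u} [Ring A]

/-- Iterates x ^ n ≡ x ^ (n + 1) y: multiplying by x ^ k on the left and y ^ k on the right links
consecutive exponents, so no commutativity of x and y is needed. -/
theorem TwoSidedIdeal.pow_sub_pow_add_mul_pow_mem {I : TwoSidedIdeal A} {x y : A} {n : ℕ}
    (h : x ^ n - x ^ (n + 1) * y ∈ I) (k : ℕ) : x ^ n - x ^ (n + k) * y ^ k ∈ I := by
  induction k with
  | zero => simp
  | succ k ih =>
    have h' := I.add_mem ih (I.mul_mem_right _ (y ^ k) (I.mul_mem_left (x ^ k) _ h))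
    convert h' using 1
    rw [mul_sub, ← mul_assoc, ← pow_add, ← pow_add, sub_mul, mul_assoc, ← pow_succ', add_comm k n,
      sub_add_sub_cancel, add_left_comm, ← add_assoc, add_comm k n, add_assoc]

theorem isDetectedByPrimeFactors_isStronglyPiRegular :
    IsDetectedByPrimeFactors IsStronglyPiRegular.{u} := by
  refine fun A _ => ⟨fun h P _ => h.of_surjective _ P.ringCon.mk'_surjective, fun h x => ?_⟩
  by_contra! hx
  let M : Set A := {m | ∃ n : ℕ, 0 < n ∧ ∃ y, m = x ^ n - x ^ (n + 1) * y}
  have h0 : (0 : A) ∉ M := by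
    rintro ⟨n, hn, y, hy⟩
    exact hx n hn y (sub_eq_zero.1 hy.symm)
  obtain ⟨P, hP⟩ := exists_maximal_disjoint h0
  have hprime : P.IsPrimeIdeal := by
    refine isPrimeIdeal_of_maximal_disjoint (M := M) ⟨_, 1, one_pos, 0, rfl⟩ hP ?_
    rintro I J hIJ _ ⟨n, hn, u, rfl⟩ hI _ ⟨m, -, v, rfl⟩ hJ
    -- With `b = x ^ m - x ^ (m + 1) * v ∈ J`, the product `x ^ n * b` is congruent modulo `P` to
    -- `x ^ (n + m + 1) * u ^ (m + 1) * b`.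
    refine ⟨x ^ (n + m) - x ^ (n + m + 1) * (v + u ^ (m + 1) * (x ^ m - x ^ (m + 1) * v)),
      ⟨n + m, by omega, _, rfl⟩, ?_⟩
    -- Since x ^ n b = x ^ (n + m) - x ^ (n + m + 1) v, the shift m + 1 is what brings the other
    -- term to exponent n + m + 1 too, giving an element of M.
    have h1 := hIJ _ (pow_sub_pow_add_mul_pow_mem hI (m + 1)) _ hJ
    convert h1 using 1
    rw [sub_mul, mul_add, mul_sub (x ^ n), ← pow_add, ← mul_assoc (x ^ n), ← pow_add,
      ← add_assoc, ← mul_assoc (x ^ (n + m + 1)), sub_sub]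
  -- A relation for x in A/P lifts to an element of M lying in P.
  obtain ⟨n, hn, q, hq⟩ := h P hprime (P.ringCon.mk' x)
  obtain ⟨y, rfl⟩ := P.ringCon.mk'_surjective q
  refine hP.1 _ ⟨n, hn, y, rfl⟩ ?_
  rw [← mk'_eq_zero_iff, map_sub, map_mul, map_pow, map_pow, hq, sub_self]

end StronglyPiRegular

theorem theorem1p13 {T : Type u} [Ring T] (R : Subring T) (E : Set T) (hE : E.Nonempty)
    (hEP : E ⊆ idempotentsCentralModPrimeRadical T) :
    (∀ e : T, IsInnerPeirceTrivial e ∨ IsOuterPeirceTrivial e →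
        e ∈ idempotentsCentralModPrimeRadical T) ∧
    (∀ C : (∀ (A : Type u) [Ring A], Prop), IsRingProperty C → IsDetectedByPrimeFactors C →
        (C R ↔ C (Subring.closure ((R : Set T) ∪ E)))) ∧
    (IsStronglyPiRegular R ↔ IsStronglyPiRegular (Subring.closure ((R : Set T) ∪ E))) := by
  have hR : R ≤ Subring.closure ((R : Set T) ∪ E) := fun x hx =>
    Subring.subset_closure (Or.inl hx)
  have transfer : ∀ C : (∀ (A : Type u) [Ring A], Prop), IsRingProperty C →
      IsDetectedByPrimeFactors C → (C R ↔ C (Subring.closure ((R : Set T) ∪ E))) :=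
    fun C hiso hC => hC.iff_of_spannedModulo hiso (Subring.inclusion_injective hR)
      fun P hP => spannedModulo_inclusion_closure hEP hR hP
  refine ⟨?_, transfer, transfer _ isRingProperty_isStronglyPiRegular
    isDetectedByPrimeFactors_isStronglyPiRegular⟩
  rintro e (he | he)
  · exact he.mem_idempotentsCentralModPrimeRadical
  · exact he.mem_idempotentsCentralModPrimeRadical
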